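/- Let $A$ be a noetherian Krull domain, that is, a noetherian integral domain with $A=\bigcap_{\mathfrak p}A_{\mathfrak p}$, where $\mathfrak p$ runs over the height one primes of $A$, such that every such $A_{\mathfrak p}$ is a discrete valuation ring and every nonzero $x\in A$ is a unit in $A_{\mathfrak p}$ for all but finitely many $\mathfrak p$. Let $B=A[[t]]$ be the ring of formal power series in one variable over $A$ (again a noetherian Krull domain). For $R\in\{A,B\}$, an $R$-module is called pseudo-null if it is finitely generated and torsion and its annihilator has height at least $2$ (the unit ideal has height $\infty$, so $0$ is pseudo-null); a pseudo-isomorphism is an $R$-linear map with pseudo-null kernel and cokernel. Every finitely generated torsion $R$-module $N$ admits a pseudo-isomorphism $N\to\bigoplus_{i=1}^n R/\mathfrak p_i^{e_i}$ with $\mathfrak p_i$ height one primes of $R$ (not necessarily distinct) and $e_i\ge 1$, where $n$ and the pairs $(\mathfrak p_i,e_i)$ are unique up to order; put $Ch_R(N)=\prod_{i=1}^n\mathfrak p_i^{e_i}$. If $N$ is finitely generated and not torsion, put $Ch_R(N)=0$. Let $M$ be a finitely generated torsion $B$-module such that $M/tM$ is a finitely generated torsion $A$-module, and let $M_t$ be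 the kernel of multiplication by $t$ on $M$ (a finitely generated $A$-module). Then $M$ is a pseudo-null $B$-module if and only if $$Ch_A(M_t)=Ch_A(M/tM).$$ Moreover, if $M/tM$ is a pseudo-null $A$-module, then $M$ is a pseudo-null $B$-module. -/

import Mathlib

open scoped PowerSeries Pointwise

/-- The set of height one primes of `A`, as a type. -/
abbrev HeightOnePrime (A : Type*) [CommRing A] : Type _ :=
  {p : PrimeSpectrum A // p.asIdeal.height = 1}

/-- A domain `A` is a Krull domain if every localization `A_p` at a height one prime is a discrete
valuation ring, `A` is the intersection of the `A_p` inside its fraction field, and every nonzero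
`x : A` is a unit in `A_p` for all but finitely many height one primes `p`. (Fields are Krull
domains: there the intersection is over the empty set and equals the fraction field.) -/
structure IsKrullDomain (A : Type*) [CommRing A] [IsDomain A] : Prop where
  isDiscreteValuationRing : ∀ p : HeightOnePrime A,
    IsDiscreteValuationRing (Localization.AtPrime p.1.asIdeal)
  iInf_localization : ⨅ p : HeightOnePrime A,
    Localization.subalgebra.ofField (FractionRing A) p.1.asIdeal.primeCompl
      (Ideal.primeCompl_le_nonZeroDivisors p.1.asIdeal) = ⊥
  finite_not_isUnit : ∀ x : A, x ≠ 0 →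
    {p : HeightOnePrime A |
      ¬ IsUnit (algebraMap A (Localization.AtPrime p.1.asIdeal) x)}.Finite

/-- A pseudo-null module: a finitely generated torsion module whose annihilator has height at
least `2` (the unit ideal has height `⊤`, so the zero module is pseudo-null). -/
structure IsPseudoNull (A M : Type*) [CommRing A] [AddCommGroup M] [Module A M] : Prop where
  finite : Module.Finite A M
  isTorsion : Module.IsTorsion A M
  two_le_height : 2 ≤ (Module.annihilator A M).height

/-- A pseudo-isomorphism: a linear map with pseudo-null kernel and cokernel. -/
structure IsPseudoIso {A M N : Type*} [CommRing A] [AddCommGroup M] [Module A M]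
    [AddCommGroup N] [Module A N] (f : M →ₗ[A] N) : Prop where
  ker : IsPseudoNull A (LinearMap.ker f)
  coker : IsPseudoNull A (N ⧸ LinearMap.range f)

/-- A finite list `(p₁, e₁), …, (pₙ, eₙ)` of height one primes of `A` (not necessarily distinct)
with positive exponents. -/
structure ElementaryData (A : Type*) [CommRing A] where
  n : ℕ
  prime : Fin n → HeightOnePrime A
  exp : Fin n → ℕ
  exp_pos : ∀ i, 0 < exp i

/-- The elementary module `A/p₁^e₁ ⊕ … ⊕ A/pₙ^eₙ`. -/
abbrev ElementaryData.Mod {A : Type*} [CommRing A] (D : ElementaryData A) : Type _ :=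
  (i : Fin D.n) → A ⧸ (D.prime i).1.asIdeal ^ D.exp i

/-- The ideal `p₁^e₁ ⋯ pₙ^eₙ`. -/
def ElementaryData.ideal {A : Type*} [CommRing A] (D : ElementaryData A) : Ideal A :=
  ∏ i : Fin D.n, (D.prime i).1.asIdeal ^ D.exp i

open Classical in
/-- The characteristic ideal `Ch_A(M)` of a finitely generated module `M` over a noetherian Krull
domain `A`: it is `0` if `M` is not torsion, and it is `p₁^e₁ ⋯ pₙ^eₙ` if `M` is torsion and
pseudo-isomorphic to `A/p₁^e₁ ⊕ … ⊕ A/pₙ^eₙ`. For finitely generated torsion modules over a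
noetherian Krull domain such an elementary module always exists and is unique up to the order of
its summands, so the inner `else` branch is never reached there and the choice is immaterial. -/
noncomputable def charIdeal (A M : Type*) [CommRing A] [AddCommGroup M] [Module A M] : Ideal A :=
  if Module.IsTorsion A M then
    if h : ∃ D : ElementaryData A, ∃ f : M →ₗ[A] D.Mod, IsPseudoIso f then h.choose.ideal else ⊥
  else ⊥

/-! Write B = A⟦X⟧ and, for a height one prime p of A, let k_p and c_p be the lengths over A_p of
the localized kernel and cokernel of X on M. Characteristic ideals over A record exactly the lengths
at height one primes (`IsKrullDomain.charIdeal_eq_iff`), so the claim is that M is pseudo-null iff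
k_p = c_p for all p. `EulerPositive` adds the inequality k_p ≤ c_p, which makes the claim stable
under extensions and also gives the last assertion: c_p = 0 forces k_p = 0.

Since M/XM is torsion, Cayley–Hamilton yields f killing M with f(0) ≠ 0, so all these lengths are
finite. By the snake lemma c_p - k_p is additive in short exact sequences, and the middle term of
such a sequence is pseudo-null iff both ends are. A sum of nonnegative terms vanishes iff each term
does, so a prime filtration reduces everything to B/P with f ∈ P.

If X ∈ P, kernel and cokernel of X are both B/P, and P has height at least 2 because it also
contains f. If X ∉ P, then k_p = 0 and the cokernel is A/P(0), with P(0) the ideal of constant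
coefficients. It remains to see that P has height at least 2 iff P(0) lies in no height one prime of
A. One direction is a height count (`PowerSeries.exists_constantCoeff_notMem`); the other is a
Nakayama argument resting on A = ⋂ A_p (`IsKrullDomain.dvd_of_forall_dvd_mul`). -/

/-! ### Lengths of localizations and their additivity -/

section LocalLength

variable {A : Type*} [CommRing A] (p : Ideal A) [p.IsPrime]
variable {N N₁ N₂ N₃ : Type*} [AddCommGroup N] [Module A N] [AddCommGroup N₁] [Module A N₁]
  [AddCommGroup N₂] [Module A N₂] [AddCommGroup N₃] [Module A N₃]

/-- The length of the localization of a module at a prime ideal. -/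
noncomputable def localLength {A : Type*} [CommRing A] (p : Ideal A) [p.IsPrime]
    (N : Type*) [AddCommGroup N] [Module A N] : ℕ∞ :=
  Module.length (Localization.AtPrime p) (LocalizedModule p.primeCompl N)

theorem localLength_eq_of_isLocalizedModule {N' : Type*} [AddCommGroup N'] [Module A N']
    [Module (Localization.AtPrime p) N'] [IsScalarTower A (Localization.AtPrime p) N']
    (f : N →ₗ[A] N') [IsLocalizedModule p.primeCompl f] :
    localLength p N = Module.length (Localization.AtPrime p) N' :=
  ((IsLocalizedModule.iso p.primeCompl f).extendScalarsOfIsLocalization p.primeCompl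
    (Localization.AtPrime p)).length_eq

theorem localLength_eq_add_of_exact (f : N₁ →ₗ[A] N₂) (g : N₂ →ₗ[A] N₃)
    (hf : Function.Injective f) (hg : Function.Surjective g) (hfg : Function.Exact f g) :
    localLength p N₂ = localLength p N₁ + localLength p N₃ :=
  Module.length_eq_add_of_exact (LocalizedModule.map p.primeCompl f)
    (LocalizedModule.map p.primeCompl g) (LocalizedModule.map_injective _ _ hf)
    (LocalizedModule.map_surjective _ _ hg) (LocalizedModule.map_exact _ _ _ hfg)

theorem LinearEquiv.localLength_eq (e : N₁ ≃ₗ[A] N₂) : localLength p N₁ = localLength p N₂ := by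
  have := localLength_eq_add_of_exact p e.toLinearMap (0 : N₂ →ₗ[A] PUnit) e.injective
    (Function.surjective_to_subsingleton _) ((e.exact_zero_iff_surjective _).2 e.surjective)
  rw [this]
  simp [localLength]

theorem localLength_eq_zero_iff : localLength p N = 0 ↔ ∀ x : N, ∃ s ∉ p, s • x = 0 := by
  rw [localLength, Module.length_eq_zero_iff, LocalizedModule.subsingleton_iff]
  rfl

theorem localLength_eq_zero_iff_of_finite [Module.Finite A N] :
    localLength p N = 0 ↔ ¬ Module.annihilator A N ≤ p := by
  rw [localLength, Module.length_eq_zero_iff, ← not_iff_not, not_subsingleton_iff_nontrivial,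
    not_not]
  have h1 := Module.mem_support_iff (R := A) (M := N) (p := ⟨p, inferInstance⟩)
  rw [Module.support_eq_zeroLocus] at h1
  exact h1.symm

theorem localLength_eq_ker_add_range (f : N₁ →ₗ[A] N₂) :
    localLength p N₁ = localLength p (LinearMap.ker f) + localLength p (LinearMap.range f) :=
  localLength_eq_add_of_exact p (LinearMap.ker f).subtype f.rangeRestrict
    (LinearMap.ker f).subtype_injective f.surjective_rangeRestrict <| by
      intro x
      simp [Subtype.ext_iff]

theorem localLength_eq_add_of_submodule (K : Submodule A N) :
    localLength p N = localLength p K + localLength p (N ⧸ K) :=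
  localLength_eq_add_of_exact p K.subtype K.mkQ K.subtype_injective K.mkQ_surjective
    (LinearMap.exact_subtype_mkQ K)

theorem localLength_eq_of_ker_of_coker (f : N₁ →ₗ[A] N₂)
    (hk : localLength p (LinearMap.ker f) = 0)
    (hc : localLength p (N₂ ⧸ LinearMap.range f) = 0) :
    localLength p N₁ = localLength p N₂ := by
  rw [localLength_eq_ker_add_range p f, localLength_eq_add_of_submodule p (LinearMap.range f),
    hk, hc, zero_add, add_zero]

theorem localLength_pi {ι : Type*} [Fintype ι] (F : ι → Type*) [∀ i, AddCommGroup (F i)]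
    [∀ i, Module A (F i)] : localLength p (∀ i, F i) = ∑ i, localLength p (F i) := by
  rw [localLength_eq_of_isLocalizedModule p (LinearMap.pi fun i =>
    LocalizedModule.mkLinearMap p.primeCompl (F i) ∘ₗ LinearMap.proj i),
    Module.length_pi_of_fintype]
  rfl

/-- Multiplicativity of the Euler characteristic `ker - coker` of endomorphisms. -/
theorem localLength_ker_add_coker (i₁ : N₁ →ₗ[A] N₁) (i₂ : N₂ →ₗ[A] N₂) (i₃ : N₃ →ₗ[A] N₃)
    (f : N₁ →ₗ[A] N₂) (g : N₂ →ₗ[A] N₃)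
    (hf : Function.Injective f) (hg : Function.Surjective g) (hfg : Function.Exact f g)
    (h₁ : f ∘ₗ i₁ = i₂ ∘ₗ f) (h₂ : g ∘ₗ i₂ = i₃ ∘ₗ g) :
    localLength p (LinearMap.ker i₂) +
        (localLength p (N₁ ⧸ LinearMap.range i₁) + localLength p (N₃ ⧸ LinearMap.range i₃)) =
      localLength p (LinearMap.ker i₁) + localLength p (LinearMap.ker i₃) +
        localLength p (N₂ ⧸ LinearMap.range i₂) := by
  have c₁ (x) : f (i₁ x) = i₂ (f x) := LinearMap.congr_fun h₁ x
  have c₂ (x) : g (i₂ x) = i₃ (g x) := LinearMap.congr_fun h₂ x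
  have gf (x) : g (f x) = 0 := hfg.apply_apply_eq_zero x
  let F₁ : LinearMap.ker i₁ →ₗ[A] LinearMap.ker i₂ :=
    f.restrict fun x hx => by simp_all [← c₁]
  let F₂ : LinearMap.ker i₂ →ₗ[A] LinearMap.ker i₃ :=
    g.restrict fun x hx => by simp_all [← c₂]
  let G₁ : (N₁ ⧸ LinearMap.range i₁) →ₗ[A] (N₂ ⧸ LinearMap.range i₂) :=
    Submodule.mapQ _ _ f (by rintro _ ⟨x, rfl⟩; exact ⟨f x, (c₁ x).symm⟩)
  let G₂ : (N₂ ⧸ LinearMap.range i₂) →ₗ[A] (N₃ ⧸ LinearMap.range i₃) :=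
    Submodule.mapQ _ _ g (by rintro _ ⟨x, rfl⟩; exact ⟨g x, (c₂ x).symm⟩)
  let δ := SnakeLemma.δ' i₁ i₂ i₃ f g hfg f g hfg h₁ h₂ (LinearMap.ker i₃).subtype
    (LinearMap.exact_subtype_ker_map i₃) (LinearMap.range i₁).mkQ
    (LinearMap.exact_map_mkQ_range i₁) hg hf
  have e₁ : Function.Exact F₁ F₂ := by
    rintro ⟨x, hx⟩
    constructor
    · intro h
      obtain ⟨y, rfl⟩ := (hfg x).1 (congrArg Subtype.val h)
      have : i₁ y = 0 := hf (by rw [c₁, map_zero]; exact hx)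
      exact ⟨⟨y, this⟩, rfl⟩
    · rintro ⟨y, hy⟩
      rw [← hy]
      exact Subtype.ext (gf y)
  have e₂ : Function.Exact F₂ δ := SnakeLemma.exact_δ'_right _ _ _ _ _ _ _ _ _ _ _
    (LinearMap.ker i₂).subtype (LinearMap.exact_subtype_ker_map i₂) _ _ _ _ _ _ F₂ rfl
    (LinearMap.ker i₃).subtype_injective
  have e₃ : Function.Exact δ G₁ := SnakeLemma.exact_δ'_left _ _ _ _ _ _ _ _ _ _ _ _ _ _ _
    (LinearMap.range i₂).mkQ (LinearMap.exact_map_mkQ_range i₂) _ _ G₁ rfl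
    (LinearMap.range i₁).mkQ_surjective
  have e₄ : Function.Exact G₁ G₂ := by
    intro x
    obtain ⟨x, rfl⟩ := Submodule.Quotient.mk_surjective _ x
    constructor
    · intro h
      obtain ⟨y, hy⟩ := (Submodule.Quotient.mk_eq_zero _).1 h
      obtain ⟨z, rfl⟩ := hg y
      obtain ⟨w, hw⟩ := (hfg (x - i₂ z)).1 (by rw [map_sub, c₂, hy, sub_self])
      refine ⟨Submodule.Quotient.mk w, ?_⟩
      change Submodule.Quotient.mk (f w) = _
      rw [hw, Submodule.Quotient.eq]
      exact ⟨-z, by simp⟩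
    · rintro ⟨y, hy⟩
      obtain ⟨y, rfl⟩ := Submodule.Quotient.mk_surjective _ y
      rw [← hy]
      change Submodule.Quotient.mk (g (f y)) = _
      rw [gf, Submodule.Quotient.mk_zero]
  have sG₂ : Function.Surjective G₂ := by
    intro x
    obtain ⟨x, rfl⟩ := Submodule.Quotient.mk_surjective _ x
    obtain ⟨y, rfl⟩ := hg x
    exact ⟨Submodule.Quotient.mk y, rfl⟩
  have iF₁ : Function.Injective F₁ := fun x y h => Subtype.ext (hf (congrArg Subtype.val h))
  -- Splitting each term of the six-term exact sequence into kernel and range turns both sides into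
  -- the same sum; no subtraction occurs, so infinite lengths are allowed.
  rw [localLength_eq_ker_add_range p F₂, localLength_eq_ker_add_range p δ,
    localLength_eq_ker_add_range p G₁, localLength_eq_ker_add_range p G₂,
    e₁.linearMap_ker_eq, e₂.linearMap_ker_eq, e₃.linearMap_ker_eq, e₄.linearMap_ker_eq,
    (LinearEquiv.ofInjective F₁ iF₁).localLength_eq p,
    LinearMap.range_eq_top.2 sG₂, Submodule.topEquiv.localLength_eq p]
  ac_rfl

theorem localLength_quotient_pow_self [IsDomain A]
    [IsDiscreteValuationRing (Localization.AtPrime p)] (e : ℕ) :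
    localLength p (A ⧸ p ^ e) = e := by
  obtain ⟨ϖ, hϖ⟩ := IsDiscreteValuationRing.exists_irreducible (Localization.AtPrime p)
  have hm := (IsDiscreteValuationRing.irreducible_iff_uniformizer ϖ).1 hϖ
  rw [localLength_eq_of_isLocalizedModule p (Submodule.toLocalizedQuotient'
    (Localization.AtPrime p) p.primeCompl (Algebra.linearMap A (Localization.AtPrime p)) (p ^ e)),
    Ideal.localized'_eq_map, Ideal.map_pow, Localization.AtPrime.map_eq_maximalIdeal, hm,
    Ideal.span_singleton_pow]
  change Ring.ord _ (ϖ ^ e) = e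
  have h1 : Ring.ord (Localization.AtPrime p) ϖ = 1 := by
    rw [Ring.ord, ← hm, Module.length_eq_one_iff]
    exact isSimpleModule_iff_isCoatom.2 (IsLocalRing.maximalIdeal.isMaximal _).out
  rw [Ring.ord_pow (mem_nonZeroDivisors_of_ne_zero hϖ.ne_zero), h1]
  simp

theorem localLength_quotient_eq_zero {I : Ideal A} (h : ¬ I ≤ p) : localLength p (A ⧸ I) = 0 := by
  rw [localLength_eq_zero_iff_of_finite, Ideal.annihilator_quotient]
  exact h

end LocalLength

/-! ### Pseudo-nullity through height one primes -/

section PseudoNull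

variable {A : Type*} [CommRing A] [IsDomain A]
variable {N : Type*} [AddCommGroup N] [Module A N]

/-- An ideal of finite height lies in a prime of the same height, and in a domain the only prime of
height 0 is `⊥`. -/
theorem two_le_height_iff (I : Ideal A) :
    2 ≤ I.height ↔ I ≠ ⊥ ∧ ∀ p : HeightOnePrime A, ¬ I ≤ p.1.asIdeal := by
  constructor
  · refine fun h => ⟨?_, fun p hp => ?_⟩
    · rintro rfl
      simp at h
    · have := h.trans (Ideal.height_mono hp)
      rw [p.2] at this
      exact absurd this (by decide)
  · rintro ⟨h0, h1⟩
    by_contra hlt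
    rw [not_le] at hlt
    obtain ⟨n, hn⟩ := ENat.ne_top_iff_exists.1 (ne_top_of_lt hlt)
    obtain ⟨J, hJ, hIJ, hJn⟩ := Ideal.exists_isPrime_height_eq hn.symm
    have hn2 : n < 2 := by
      rw [← hn] at hlt
      exact_mod_cast hlt
    interval_cases n
    · exact h0 (Ideal.height_eq_zero_iff_eq_bot.1 hn.symm)
    · exact h1 ⟨⟨J, hJ⟩, by simpa using hJn⟩ hIJ

theorem Module.IsTorsion.annihilator_ne_bot [Module.Finite A N] (h : Module.IsTorsion A N) :
    Module.annihilator A N ≠ ⊥ := by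
  obtain ⟨a, ha, ha0⟩ := Submodule.annihilator_top_inter_nonZeroDivisors h
  rw [SetLike.mem_coe, Submodule.annihilator_top] at ha
  exact (Submodule.ne_bot_iff _).2 ⟨a, ha, nonZeroDivisors.ne_zero ha0⟩

theorem isTorsion_of_annihilator_ne_bot (h : Module.annihilator A N ≠ ⊥) :
    Module.IsTorsion A N := by
  obtain ⟨a, ha, ha0⟩ := (Submodule.ne_bot_iff _).1 h
  exact fun {x} => ⟨⟨a, mem_nonZeroDivisors_of_ne_zero ha0⟩, Module.mem_annihilator.1 ha x⟩

theorem isPseudoNull_iff [Module.Finite A N] :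
    IsPseudoNull A N ↔ Module.annihilator A N ≠ ⊥ ∧
      ∀ p : HeightOnePrime A, ¬ Module.annihilator A N ≤ p.1.asIdeal := by
  rw [← two_le_height_iff]
  refine ⟨fun h => h.two_le_height, fun h => ⟨inferInstance, ?_, h⟩⟩
  exact isTorsion_of_annihilator_ne_bot ((two_le_height_iff _).1 h).1

theorem isPseudoNull_iff_localLength [Module.Finite A N] :
    IsPseudoNull A N ↔ Module.annihilator A N ≠ ⊥ ∧
      ∀ p : HeightOnePrime A, localLength p.1.asIdeal N = 0 := by
  simp_rw [isPseudoNull_iff, localLength_eq_zero_iff_of_finite]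

theorem IsPseudoNull.localLength_eq_zero (h : IsPseudoNull A N) (p : HeightOnePrime A) :
    localLength p.1.asIdeal N = 0 :=
  have := h.finite
  (isPseudoNull_iff_localLength.1 h).2 p

theorem isPseudoNull_of_forall_smul_eq_zero [Module.Finite A N]
    (hN : Module.annihilator A N ≠ ⊥)
    (h : ∀ p : HeightOnePrime A, ∀ x : N, ∃ s ∉ p.1.asIdeal, s • x = 0) : IsPseudoNull A N :=
  isPseudoNull_iff_localLength.2 ⟨hN, fun p => (localLength_eq_zero_iff _).2 (h p)⟩

end PseudoNull

/-! ### Elementary modules and their ideals -/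

section ElementaryData

variable {A : Type*} [CommRing A]

theorem HeightOnePrime.eq_of_le {p q : HeightOnePrime A} (h : p.1.asIdeal ≤ q.1.asIdeal) :
    p = q := by
  by_contra hne
  have hlt : p.1.asIdeal < q.1.asIdeal :=
    lt_of_le_of_ne h fun h' => hne (Subtype.ext (PrimeSpectrum.ext h'))
  have := Ideal.height_add_one_le_of_lt_of_isPrime hlt
  rw [p.2, q.2] at this
  exact absurd this (by decide)

theorem HeightOnePrime.pow_le_iff {p q : HeightOnePrime A} {e : ℕ} (he : 0 < e) :
    p.1.asIdeal ^ e ≤ q.1.asIdeal ↔ p = q := by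
  refine ⟨fun h => eq_of_le ((Ideal.IsPrime.pow_le_iff he.ne').1 h), ?_⟩
  rintro rfl
  exact Ideal.pow_le_self he.ne'

open Classical in
/-- The exponent of `p` in `p₁^e₁ ⋯ pₙ^eₙ`. -/
noncomputable def ElementaryData.mult (D : ElementaryData A) (p : HeightOnePrime A) : ℕ :=
  ∑ i with D.prime i = p, D.exp i

theorem ElementaryData.localLength_mod [IsDomain A] (D : ElementaryData A) (p : HeightOnePrime A)
    [IsDiscreteValuationRing (Localization.AtPrime p.1.asIdeal)] :
    localLength p.1.asIdeal D.Mod = D.mult p := by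
  classical
  rw [localLength_pi, mult, Nat.cast_sum, Finset.sum_filter]
  refine Finset.sum_congr rfl fun i _ => ?_
  split_ifs with h
  · rw [h, localLength_quotient_pow_self]
  · exact localLength_quotient_eq_zero _ fun h' =>
      h ((HeightOnePrime.pow_le_iff (D.exp_pos i)).1 h')

theorem ElementaryData.ideal_eq_prod_mult (D : ElementaryData A) (U : Finset (HeightOnePrime A))
    (hU : ∀ i, D.prime i ∈ U) : D.ideal = ∏ p ∈ U, p.1.asIdeal ^ D.mult p := by
  classical
  rw [ideal, ← Finset.prod_fiberwise_of_maps_to (g := D.prime) (t := U) fun i _ => hU i]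
  refine Finset.prod_congr rfl fun p _ => ?_
  rw [mult, ← Finset.prod_pow_eq_pow_sum]
  refine Finset.prod_congr (by congr) fun i hi => ?_
  rw [(Finset.mem_filter.1 hi).2]

/-- Height one primes other than p contain an element outside p, so they become the unit ideal in
the local ring at p. -/
theorem ElementaryData.map_ideal (D : ElementaryData A) (p : HeightOnePrime A) :
    D.ideal.map (algebraMap A (Localization.AtPrime p.1.asIdeal)) =
      IsLocalRing.maximalIdeal (Localization.AtPrime p.1.asIdeal) ^ D.mult p := by
  classical
  rw [ideal, ← Ideal.mapHom_apply, map_prod, mult, ← Finset.prod_pow_eq_pow_sum, Finset.prod_filter]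
  refine Finset.prod_congr rfl fun i _ => ?_
  split_ifs with h
  · rw [Ideal.mapHom_apply, h, Ideal.map_pow, Localization.AtPrime.map_eq_maximalIdeal]
  · rw [← HeightOnePrime.pow_le_iff (D.exp_pos i), SetLike.not_le_iff_exists]
      at h
    obtain ⟨x, hx, hxp⟩ := h
    rw [Ideal.mapHom_apply, Ideal.one_eq_top, Ideal.eq_top_iff_one]
    have hu : IsUnit (algebraMap A (Localization.AtPrime p.1.asIdeal) x) :=
      IsLocalization.map_units _ (⟨x, hxp⟩ : p.1.asIdeal.primeCompl)
    exact (Ideal.eq_top_iff_one _).1 (Ideal.eq_top_of_isUnit_mem _ (Ideal.mem_map_of_mem _ hx) hu)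

/-- Exponents can be recovered locally: in a discrete valuation ring the powers of the maximal ideal
are distinct. This makes `charIdeal` independent of the chosen elementary module. -/
theorem ElementaryData.ideal_eq_iff [IsDomain A] (hA : IsKrullDomain A) (D D' : ElementaryData A) :
    D.ideal = D'.ideal ↔ ∀ p, D.mult p = D'.mult p := by
  classical
  constructor
  · intro h p
    have := hA.isDiscreteValuationRing p
    have h' := D.map_ideal p
    rw [h, D'.map_ideal p] at h'
    exact ((Ideal.pow_right_strictAnti _ (IsDiscreteValuationRing.not_a_field _)
      (IsLocalRing.maximalIdeal.isMaximal _).ne_top).injective h').symm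
  · intro h
    let U := Finset.univ.image D.prime ∪ Finset.univ.image D'.prime
    rw [D.ideal_eq_prod_mult U (by simp [U]), D'.ideal_eq_prod_mult U (by simp [U])]
    simp_rw [h]

theorem IsPseudoIso.localLength_eq [IsDomain A] {N : Type*} [AddCommGroup N] [Module A N]
    {D : ElementaryData A} {f : N →ₗ[A] D.Mod} (hf : IsPseudoIso f) (p : HeightOnePrime A)
    [IsDiscreteValuationRing (Localization.AtPrime p.1.asIdeal)] :
    localLength p.1.asIdeal N = D.mult p := by
  rw [localLength_eq_of_ker_of_coker _ f (hf.ker.localLength_eq_zero p)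
    (hf.coker.localLength_eq_zero p), D.localLength_mod]

end ElementaryData

/-! ### The structure theorem up to pseudo-isomorphism -/

section Structure

variable {A : Type*} [CommRing A] [IsDomain A] [IsNoetherianRing A]
variable {N : Type*} [AddCommGroup N] [Module A N] [Module.Finite A N]

/-- Over a noetherian domain, a finite torsion module is, locally at a prime `p` whose local ring
is a discrete valuation ring, a direct sum of modules `A/p^e`. -/
theorem exists_map_to_quotient_pow (p : Ideal A) [p.IsPrime]
    [IsDiscreteValuationRing (Localization.AtPrime p)] (hN : Module.annihilator A N ≠ ⊥) :
    ∃ (k : ℕ) (e : Fin k → ℕ) (f : N →ₗ[A] (∀ i, A ⧸ p ^ e i)),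
      (∀ x, f x = 0 → ∃ s ∉ p, s • x = 0) ∧ ∀ y, ∃ s ∉ p, ∃ x, f x = s • y := by
  classical
  let R := Localization.AtPrime p
  let S := p.primeCompl
  have htors : Module.IsTorsion R (LocalizedModule S N) := by
    obtain ⟨a, ha, ha0⟩ := (Submodule.ne_bot_iff _).1 hN
    have ha' : algebraMap A R a ≠ 0 := by
      rwa [ne_eq, IsLocalization.to_map_eq_zero_iff R p.primeCompl_le_nonZeroDivisors]
    intro x
    refine ⟨⟨algebraMap A R a, mem_nonZeroDivisors_of_ne_zero ha'⟩, ?_⟩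
    induction x with
    | h x s =>
      change algebraMap A R a • LocalizedModule.mk x s = 0
      rw [algebraMap_smul, LocalizedModule.smul'_mk, Module.mem_annihilator.1 ha,
        LocalizedModule.zero_mk]
  obtain ⟨ι, _, ϖ, hϖ, e, ⟨E⟩⟩ := Module.equiv_directSum_of_isTorsion htors
  have hloc (n : ℕ) (i : ι) : R ∙ ϖ i ^ n =
      Submodule.localized' R S (Algebra.linearMap A R) (p ^ n) := by
    rw [Ideal.localized'_eq_map, Ideal.map_pow, Localization.AtPrime.map_eq_maximalIdeal,
      (IsDiscreteValuationRing.irreducible_iff_uniformizer _).1 (hϖ i), Ideal.span_singleton_pow]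
  let σ := (Fintype.equivFin ι).symm
  let e' := fun i => e (σ i)
  let E' : LocalizedModule S N ≃ₗ[R]
      (∀ i, R ⧸ Submodule.localized' R S (Algebra.linearMap A R) (p ^ e' i)) :=
    E ≪≫ₗ DirectSum.linearEquivFunOnFintype R ι _ ≪≫ₗ
      LinearEquiv.piCongrLeft' R _ σ.symm ≪≫ₗ
      LinearEquiv.piCongrRight fun i => Submodule.quotEquivOfEq _ _ (hloc _ _)
  let g : (∀ i, A ⧸ p ^ e' i) →ₗ[A]
      (∀ i, R ⧸ Submodule.localized' R S (Algebra.linearMap A R) (p ^ e' i)) :=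
    LinearMap.pi fun i => Submodule.toLocalizedQuotient' R S (Algebra.linearMap A R) (p ^ e' i) ∘ₗ
      LinearMap.proj i
  have : IsLocalizedModule S g := IsLocalizedModule.pi S _
  have : Module.FinitePresentation A N := Module.finitePresentation_of_finite A N
  -- The local decomposition descends to N after clearing a denominator s, because N is finitely
  -- presented; s is invertible at p, so kernel and cokernel still vanish there.
  obtain ⟨h, s, hs⟩ := Module.FinitePresentation.exists_lift_of_isLocalizedModule S g
    ((E'.toLinearMap.restrictScalars A) ∘ₗ LocalizedModule.mkLinearMap S N)
  let EA := E'.restrictScalars A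
  have hs' (x : N) : g (h x) = EA (LocalizedModule.mkLinearMap S N (s.1 • x)) := by
    rw [map_smul, map_smul]
    exact LinearMap.congr_fun hs x
  refine ⟨_, e', h, fun x hx => ?_, fun y => ?_⟩
  · have h0 := hs' x
    rw [hx, map_zero] at h0
    have h1 := EA.map_eq_zero_iff.1 h0.symm
    obtain ⟨c, hc⟩ := (IsLocalizedModule.eq_zero_iff S _).1 h1
    refine ⟨(c * s : S).1, (c * s : S).2, ?_⟩
    rw [Submonoid.coe_mul, mul_smul]
    exact hc
  · obtain ⟨⟨n, t⟩, hn⟩ := IsLocalizedModule.surj S (LocalizedModule.mkLinearMap S N)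
      (EA.symm (g y))
    replace hn : t.1 • EA.symm (g y) = LocalizedModule.mkLinearMap S N n := hn
    have h1 : g ((s * t : S).1 • y) = g (h n) := by
      rw [hs', map_smul, map_smul, ← hn, Submonoid.coe_mul, mul_smul, map_smul, map_smul,
        EA.apply_symm_apply]
    obtain ⟨c, hc⟩ := IsLocalizedModule.exists_of_eq (S := S) h1
    refine ⟨(c * (s * t) : S).1, (c * (s * t) : S).2, c.1 • n, ?_⟩
    rw [map_smul, Submonoid.coe_mul, mul_smul]
    exact hc.symm

/-- The local structure theorem may produce exponents 0, while `ElementaryData` wants positive ones;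
the corresponding factors are zero and can be dropped. -/
theorem exists_isPseudoIso_of_family {ι : Type*} [Fintype ι] (q : ι → HeightOnePrime A)
    (e : ι → ℕ) (hN : Module.annihilator A N ≠ ⊥)
    (f : N →ₗ[A] (∀ i, A ⧸ (q i).1.asIdeal ^ e i))
    (hker : ∀ p : HeightOnePrime A, ∀ x, f x = 0 → ∃ s ∉ p.1.asIdeal, s • x = 0)
    (hcoker : ∀ p : HeightOnePrime A, ∀ y, ∃ s ∉ p.1.asIdeal, ∃ x, f x = s • y) :
    ∃ (D : ElementaryData A) (g : N →ₗ[A] D.Mod), IsPseudoIso g := by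
  classical
  let σ := (Fintype.equivFin {i // 0 < e i}).symm
  let D : ElementaryData A := ⟨_, fun i => q (σ i), fun i => e (σ i), fun i => (σ i).2⟩
  let r : (∀ i, A ⧸ (q i).1.asIdeal ^ e i) →ₗ[A]
      (∀ i : {i // 0 < e i}, A ⧸ (q i).1.asIdeal ^ e i) :=
    LinearMap.pi fun i => LinearMap.proj i.1
  have hr : Function.Bijective r := by
    constructor
    · intro x y hxy
      ext i
      by_cases hi : 0 < e i
      · exact congrFun hxy ⟨i, hi⟩
      · have : Subsingleton (A ⧸ (q i).1.asIdeal ^ e i) := by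
          rw [Nat.eq_zero_of_not_pos hi, pow_zero, Ideal.one_eq_top]
          exact Ideal.Quotient.subsingleton_iff.2 rfl
        exact Subsingleton.elim _ _
    · intro y
      refine ⟨fun i => if hi : 0 < e i then y ⟨i, hi⟩ else 0, ?_⟩
      ext i
      simp [r, i.2]
  let E : (∀ i, A ⧸ (q i).1.asIdeal ^ e i) ≃ₗ[A] D.Mod :=
    LinearEquiv.ofBijective r hr ≪≫ₗ LinearEquiv.piCongrLeft' A _ σ.symm
  refine ⟨D, E.toLinearMap ∘ₗ f, ?_, ?_⟩
  · refine isPseudoNull_of_forall_smul_eq_zero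
      (fun h => hN (le_bot_iff.1 (h ▸
        LinearMap.annihilator_le_of_injective _ (Submodule.subtype_injective _))))
      fun p x => ?_
    obtain ⟨s, hs, hx⟩ := hker p x.1 (E.map_eq_zero_iff.1 x.2)
    exact ⟨s, hs, Subtype.ext hx⟩
  · refine isPseudoNull_of_forall_smul_eq_zero (fun h => ?_) fun p y => ?_
    · have h0 : D.ideal ≠ ⊥ := by
        rw [ElementaryData.ideal, ← Ideal.zero_eq_bot, Finset.prod_ne_zero_iff]
        exact fun i _ => pow_ne_zero _ (Ideal.ne_bot_of_height_eq_one (D.prime i).2)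
      refine h0 (le_bot_iff.1 (h ▸ fun a ha => Module.mem_annihilator.2 fun y => ?_))
      obtain ⟨y, rfl⟩ := Submodule.Quotient.mk_surjective _ y
      have : a • y = 0 := by
        ext i
        obtain ⟨z, hz⟩ := Ideal.Quotient.mk_surjective (y i)
        have ha' : a ∈ (D.prime i).1.asIdeal ^ D.exp i :=
          Finset.inf_le (f := fun i => (D.prime i).1.asIdeal ^ D.exp i) (Finset.mem_univ i)
            (Ideal.prod_le_inf ha)
        change a • y i = 0
        rw [← hz]
        exact Ideal.Quotient.eq_zero_iff_mem.2 (Ideal.mul_mem_right _ _ ha')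
      rw [← Submodule.Quotient.mk_smul, this, Submodule.Quotient.mk_zero]
    · obtain ⟨y, rfl⟩ := Submodule.Quotient.mk_surjective _ y
      obtain ⟨s, hs, x, hx⟩ := hcoker p (E.symm y)
      refine ⟨s, hs, ?_⟩
      rw [← Submodule.Quotient.mk_smul, Submodule.Quotient.mk_eq_zero]
      refine ⟨x, ?_⟩
      simp [hx]

/-- A finite torsion module over a noetherian Krull domain is pseudo-isomorphic to an elementary
module. -/
theorem IsKrullDomain.exists_isPseudoIso (hA : IsKrullDomain A)
    (hN : Module.annihilator A N ≠ ⊥) :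
    ∃ (D : ElementaryData A) (g : N →ₗ[A] D.Mod), IsPseudoIso g := by
  classical
  obtain ⟨a, ha, ha0⟩ := (Submodule.ne_bot_iff _).1 hN
  -- Only the finitely many height one primes containing the annihilating element a can contribute;
  -- at any other prime a itself kills N locally.
  have hfin : {p : HeightOnePrime A | a ∈ p.1.asIdeal}.Finite := by
    refine (hA.finite_not_isUnit a ha0).subset fun p hp => ?_
    rwa [Set.mem_ofPred_eq, IsLocalization.AtPrime.isUnit_to_map_iff _ p.1.asIdeal,
      Ideal.mem_primeCompl_iff, not_not]
  let T := {p : HeightOnePrime A // a ∈ p.1.asIdeal}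
  have : Fintype T := hfin.fintype
  have hloc (p : HeightOnePrime A) :=
    have := hA.isDiscreteValuationRing p
    exists_map_to_quotient_pow p.1.asIdeal hN
  choose k e f hker hcoker using hloc
  refine exists_isPseudoIso_of_family (ι := Σ p : T, Fin (k p.1)) (fun i => i.1.1)
    (fun i => e i.1.1 i.2) hN (LinearMap.pi fun i => LinearMap.proj i.2 ∘ₗ f i.1.1) ?_ ?_
  · intro p x hx
    by_cases hp : a ∈ p.1.asIdeal
    · exact hker p x (funext fun j => congrFun hx ⟨⟨p, hp⟩, j⟩)
    · exact ⟨a, hp, Module.mem_annihilator.1 ha x⟩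
  · intro p y
    let F : N →ₗ[A] (∀ i : Σ p : T, Fin (k p.1), A ⧸ i.1.1.1.asIdeal ^ e i.1.1 i.2) :=
      LinearMap.pi fun i => LinearMap.proj i.2 ∘ₗ f i.1.1
    obtain ⟨s, hs, x, hx⟩ : ∃ s ∉ p.1.asIdeal, ∃ x, ∀ i : Σ p : T, Fin (k p.1),
        i.1.1 = p → F x i = s • y i := by
      by_cases hp : a ∈ p.1.asIdeal
      · obtain ⟨s, hs, x, hx⟩ := hcoker p fun j => y ⟨⟨p, hp⟩, j⟩
        refine ⟨s, hs, x, ?_⟩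
        rintro ⟨⟨q, hq⟩, j⟩ rfl
        exact congrFun hx j
      · exact ⟨1, p.1.asIdeal.one_notMem, 0, fun i hi => absurd (hi ▸ i.1.2) hp⟩
    -- Components at primes other than p vanish locally at p, so the error there is killed by
    -- multipliers outside p; their product serves all components at once.
    have hw (i : Σ p : T, Fin (k p.1)) : ∃ t ∉ p.1.asIdeal, t • (s • y i - F x i) = 0 := by
      by_cases hi : i.1.1 = p
      · exact ⟨1, p.1.asIdeal.one_notMem, by rw [hx i hi, sub_self, smul_zero]⟩
      · refine (localLength_eq_zero_iff _).1 (localLength_quotient_eq_zero _ fun h => ?_) _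
        exact hi (HeightOnePrime.eq_of_le (p.1.isPrime.le_of_pow_le h))
    choose t ht htw using hw
    have hprod : ∏ i, t i ∉ p.1.asIdeal := by
      rw [Ideal.IsPrime.prod_mem_iff]
      exact fun ⟨i, _, hi⟩ => ht i hi
    refine ⟨(∏ i, t i) * s, fun h => (p.1.isPrime.mem_or_mem h).elim hprod hs,
      (∏ i, t i) • x, ?_⟩
    ext i
    rw [map_smul, mul_smul, Pi.smul_apply, Pi.smul_apply, Pi.smul_apply, eq_comm, ← sub_eq_zero,
      ← smul_sub, ← Finset.prod_erase_mul _ _ (Finset.mem_univ i), mul_smul, htw, smul_zero]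

/-- The characteristic ideal determines, and is determined by, the local lengths. -/
theorem IsKrullDomain.exists_charIdeal_eq (hA : IsKrullDomain A) (hN : Module.IsTorsion A N) :
    ∃ D : ElementaryData A, charIdeal A N = D.ideal ∧
      ∀ p : HeightOnePrime A, localLength p.1.asIdeal N = D.mult p := by
  have h := hA.exists_isPseudoIso hN.annihilator_ne_bot
  refine ⟨h.choose, by rw [charIdeal, if_pos hN, dif_pos h], fun p => ?_⟩
  obtain ⟨f, hf⟩ := h.choose_spec
  have := hA.isDiscreteValuationRing p
  exact hf.localLength_eq p

theorem IsKrullDomain.localLength_ne_top (hA : IsKrullDomain A) (hN : Module.IsTorsion A N)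
    (p : HeightOnePrime A) : localLength p.1.asIdeal N ≠ ⊤ := by
  obtain ⟨D, -, hD⟩ := hA.exists_charIdeal_eq hN
  rw [hD p]
  exact ENat.natCast_ne_top _

theorem IsKrullDomain.charIdeal_eq_iff (hA : IsKrullDomain A) (hN : Module.IsTorsion A N)
    {N' : Type*} [AddCommGroup N'] [Module A N'] [Module.Finite A N']
    (hN' : Module.IsTorsion A N') :
    charIdeal A N = charIdeal A N' ↔
      ∀ p : HeightOnePrime A, localLength p.1.asIdeal N = localLength p.1.asIdeal N' := by
  obtain ⟨D, hD, hDl⟩ := hA.exists_charIdeal_eq hN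
  obtain ⟨D', hD', hDl'⟩ := hA.exists_charIdeal_eq hN'
  simp_rw [hD, hD', ElementaryData.ideal_eq_iff hA, hDl, hDl', Nat.cast_inj]

end Structure

/-! ### Primes of A⟦X⟧ and their constant coefficients -/

section PowerSeriesPrimes

variable {A : Type*} [CommRing A]

/-- A ratio `v i / u i` independent of `i` lies in the Krull domain `A` as soon as no height one
prime contains all the denominators. -/
theorem IsKrullDomain.exists_eq_mul_of_cross_mul_eq [IsDomain A] (hA : IsKrullDomain A)
    {ι : Type*} (u v : ι → A) (huv : ∀ i j, u i * v j = u j * v i) (h0 : ∃ i, u i ≠ 0)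
    (hp : ∀ p : HeightOnePrime A, ∃ i, u i ∉ p.1.asIdeal) : ∃ a, ∀ i, v i = a * u i := by
  obtain ⟨i₀, hi₀⟩ := h0
  let K := FractionRing A
  have hinj : Function.Injective (algebraMap A K) := IsFractionRing.injective A K
  have hne {i} (hi : u i ≠ 0) : algebraMap A K (u i) ≠ 0 := fun h =>
    hi (hinj (h.trans (map_zero _).symm))
  have hmem : algebraMap A K (v i₀) * (algebraMap A K (u i₀))⁻¹ ∈
      ⨅ p : HeightOnePrime A, Localization.subalgebra.ofField K p.1.asIdeal.primeCompl
        (Ideal.primeCompl_le_nonZeroDivisors p.1.asIdeal) := by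
    rw [Algebra.mem_iInf]
    -- The fraction equals v i / u i for every i with u i ≠ 0; an i with u i ∉ p shows that it lies
    -- in the localization at p.
    intro p
    obtain ⟨i, hi⟩ := hp p
    refine ⟨v i, u i, hi, ?_⟩
    have hi0 : u i ≠ 0 := fun h => hi (h ▸ zero_mem _)
    rw [← div_eq_mul_inv, ← div_eq_mul_inv, div_eq_div_iff (hne hi₀) (hne hi0), ← map_mul,
      ← map_mul, mul_comm, huv i i₀, mul_comm]
  rw [hA.iInf_localization, Algebra.mem_bot] at hmem
  obtain ⟨a, ha⟩ := hmem
  have ha' : v i₀ = a * u i₀ := by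
    apply hinj
    rw [map_mul, ha, inv_mul_cancel_right₀ (hne hi₀)]
  refine ⟨a, fun i => mul_left_cancel₀ hi₀ ?_⟩
  rw [huv i₀ i, ha']
  ring

open PowerSeries

theorem PowerSeries.span_X_le_jacobson : Ideal.span {(X : A⟦X⟧)} ≤ Ideal.jacobson ⊥ := by
  rw [Ideal.span_singleton_le_iff_mem, Ideal.mem_jacobson_bot]
  intro y
  rw [PowerSeries.isUnit_iff_constantCoeff]
  simp

/-- Strip the largest power of X from a nonzero element of P; as X ∉ P, the remaining factor is in
P. -/
theorem PowerSeries.exists_mem_not_X_dvd [IsDomain A] [IsNoetherianRing A]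
    {P : Ideal A⟦X⟧} [P.IsPrime] (hP : P ≠ ⊥) (hX : (X : A⟦X⟧) ∉ P) : ∃ f ∈ P, ¬ X ∣ f := by
  obtain ⟨f, hf, hf0⟩ := (Submodule.ne_bot_iff _).1 hP
  obtain ⟨n, g, hg, rfl⟩ := WfDvdMonoid.max_power_factor hf0 (X_irreducible (R := A))
  exact ⟨g, (‹P.IsPrime›.mem_or_mem hf).resolve_left fun h => hX (‹P.IsPrime›.mem_of_pow_mem n h),
    hg⟩

/-- If the constant coefficients of a nonzero prime `P` of `A⟦X⟧` not containing `X` are not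
contained in a height one prime, then `P` has grade at least two. -/
theorem IsKrullDomain.dvd_of_forall_dvd_mul [IsDomain A] [IsNoetherianRing A]
    (hA : IsKrullDomain A) {P : Ideal A⟦X⟧} [P.IsPrime] (hP : P ≠ ⊥) (hX : (X : A⟦X⟧) ∉ P)
    (hp : ∀ p : HeightOnePrime A, ∃ f ∈ P, constantCoeff f ∉ p.1.asIdeal)
    {b c : A⟦X⟧} (hb : b ≠ 0) (hc : ∀ f ∈ P, b ∣ c * f) : b ∣ c := by
  obtain ⟨f₀, hf₀P, hf₀⟩ := exists_mem_not_X_dvd hP hX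
  let J : Ideal A⟦X⟧ := (Ideal.span {b}).colon P
  have hJ {c : A⟦X⟧} : c ∈ J ↔ ∀ f ∈ P, b ∣ c * f := by
    simp [J, Submodule.mem_colon, Ideal.mem_span_singleton]
  -- With c f = b φ(f), symmetry of c f g gives f φ(g) = g φ(f). Hence the constant terms of φ(f)
  -- and f have a common ratio a in A, and c - b a is X times another element of J. Nakayama then
  -- gives J ≤ (b).
  have key : J ≤ Ideal.span {b} ⊔ Ideal.span {(X : A⟦X⟧)} • J := by
    intro c hc
    have hc' (f : P) : b ∣ c * f.1 := hJ.1 hc f.1 f.2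
    choose φ hφ using hc'
    obtain ⟨a, ha⟩ := hA.exists_eq_mul_of_cross_mul_eq (fun f : P => constantCoeff f.1)
      (fun f => constantCoeff (φ f))
      (fun f g => by
        rw [← map_mul, ← map_mul]
        congr 1
        apply mul_left_cancel₀ hb
        rw [mul_left_comm, ← hφ, mul_left_comm b, ← hφ]
        ring)
      ⟨⟨f₀, hf₀P⟩, fun h => hf₀ (X_dvd_iff.2 h)⟩
      (fun p => by
        obtain ⟨f, hf, hfp⟩ := hp p
        exact ⟨⟨f, hf⟩, hfp⟩)
    have hdvd (f : P) : (X : A⟦X⟧) ∣ φ f - C a * f.1 := by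
      rw [X_dvd_iff, map_sub, map_mul, constantCoeff_C, ha, sub_self]
    choose ψ hψ using hdvd
    have hsub (f : P) : (c - b * C a) * f.1 = b * (X * ψ f) := by
      rw [← hψ, sub_mul, hφ]
      ring
    obtain ⟨c', hc'⟩ : (X : A⟦X⟧) ∣ c - b * C a :=
      (X_prime.dvd_or_dvd (a := c - b * C a) (b := f₀)
        ⟨b * ψ ⟨f₀, hf₀P⟩, by rw [hsub ⟨f₀, hf₀P⟩]; ring⟩).resolve_right hf₀
    have hc'J : c' ∈ J := hJ.2 fun f hf => ⟨ψ ⟨f, hf⟩, by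
      apply mul_left_cancel₀ (X_ne_zero (R := A))
      rw [← mul_assoc, ← hc', hsub ⟨f, hf⟩]
      ring⟩
    rw [show c = b * C a + X * c' by rw [← hc']; ring]
    exact Submodule.add_mem_sup (Ideal.mul_mem_right _ _ (Ideal.mem_span_singleton_self b))
      (Submodule.smul_mem_smul (Ideal.mem_span_singleton_self X) hc'J)
  have := Submodule.le_of_le_smul_of_le_jacobson_bot (IsNoetherian.noetherian J)
    PowerSeries.span_X_le_jacobson key
  exact Ideal.mem_span_singleton.1 (this (hJ.2 hc))

/-- P is minimal over any nonzero principal ideal (b) that it contains, hence associated to B/(b):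
it is the annihilator of the class of some c. -/
theorem exists_eq_colon_of_height_eq_one {B : Type*} [CommRing B] [IsDomain B]
    [IsNoetherianRing B] {P : Ideal B} [P.IsPrime] (hP : P.height = 1) :
    ∃ b c : B, b ≠ 0 ∧ ∀ f, f ∈ P ↔ b ∣ c * f := by
  obtain ⟨b, hb, hb0⟩ := (Submodule.ne_bot_iff _).1 (Ideal.ne_bot_of_height_eq_one hP)
  have hmin : P ∈ (Ideal.span {b}).minimalPrimes := by
    refine Ideal.mem_minimalPrimes_of_height_le ((Ideal.span_singleton_le_iff_mem _).2 hb) ?_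
    rw [hP]
    exact Ideal.one_le_height_span_singleton_of_mem_nonZeroDivisors
      (mem_nonZeroDivisors_of_ne_zero hb0)
  have hass : P ∈ associatedPrimes B (B ⧸ Ideal.span {b}) := by
    apply Module.associatedPrimes.minimalPrimes_annihilator_subset_associatedPrimes
    rwa [Ideal.annihilator_quotient]
  obtain ⟨-, x, hx⟩ := isAssociatedPrime_iff.1 hass
  obtain ⟨c, rfl⟩ := Ideal.Quotient.mk_surjective x
  refine ⟨b, c, hb0, fun f => ?_⟩
  rw [hx, Submodule.mem_colon_singleton, Submodule.mem_bot, Algebra.smul_def,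
    Ideal.Quotient.algebraMap_eq, ← map_mul, Ideal.Quotient.eq_zero_iff_mem,
    Ideal.mem_span_singleton, mul_comm]

/-- The constant coefficients of a height one prime of `A⟦X⟧` other than `(X)` are contained in
a height one prime of `A`. -/
theorem IsKrullDomain.exists_constantCoeff_mem [IsDomain A] [IsNoetherianRing A]
    (hA : IsKrullDomain A) {P : Ideal A⟦X⟧} [P.IsPrime] (hP : P.height = 1) (hX : (X : A⟦X⟧) ∉ P) :
    ∃ p : HeightOnePrime A, ∀ f ∈ P, constantCoeff f ∈ p.1.asIdeal := by
  by_contra! h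
  obtain ⟨b, c, hb, hbc⟩ := exists_eq_colon_of_height_eq_one hP
  have := hA.dvd_of_forall_dvd_mul (Ideal.ne_bot_of_height_eq_one hP) hX h hb
    fun f hf => (hbc f).1 hf
  exact ‹P.IsPrime›.ne_top ((Ideal.eq_top_iff_one _).2 ((hbc 1).2 (by rwa [mul_one])))

/-- The quotient by (X) is A, and in a noetherian ring dividing by one element of a prime lowers its
height by at most one. -/
theorem PowerSeries.height_comap_constantCoeff_le [IsNoetherianRing A] (p : Ideal A) [p.IsPrime] :
    (p.comap (constantCoeff (R := A))).height ≤ p.height + 1 := by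
  have hsurj : Function.Surjective (constantCoeff (R := A)) := constantCoeff_surj
  have hXmem : (X : A⟦X⟧) ∈ p.comap (constantCoeff (R := A)) := by simp
  refine (Ideal.height_le_height_add_one_of_mem hXmem).trans ?_
  gcongr
  have hker : RingHom.ker (constantCoeff (R := A)) = Ideal.span {X} := by
    ext f
    rw [RingHom.mem_ker, Ideal.mem_span_singleton, X_dvd_iff]
  let e : A⟦X⟧ ⧸ Ideal.span {(X : A⟦X⟧)} ≃+* A :=
    (Ideal.quotEquivOfEq hker.symm).trans (RingHom.quotientKerEquivOfSurjective hsurj)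
  have : (p.comap (constantCoeff (R := A))).map (Ideal.Quotient.mk (Ideal.span {X})) =
      p.comap (e : A⟦X⟧ ⧸ Ideal.span {(X : A⟦X⟧)} →+* A) := by
    have : p.comap (constantCoeff (R := A)) =
      (p.comap (e : A⟦X⟧ ⧸ Ideal.span {(X : A⟦X⟧)} →+* A)).comap (Ideal.Quotient.mk _) := rfl
    rw [this, Ideal.map_comap_of_surjective _ Ideal.Quotient.mk_surjective]
  rw [this]
  exact (RingEquiv.height_comap e p).le

/-- The constant coefficients of a prime of `A⟦X⟧` of height at least two not containing `X` are
not contained in a height one prime of `A`. -/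
theorem PowerSeries.exists_constantCoeff_notMem [IsDomain A] [IsNoetherianRing A]
    {P : Ideal A⟦X⟧} [P.IsPrime] (hP : 2 ≤ P.height) (hX : (X : A⟦X⟧) ∉ P) (p : HeightOnePrime A) :
    ∃ f ∈ P, constantCoeff f ∉ p.1.asIdeal := by
  by_contra! h
  have hlt : P < p.1.asIdeal.comap (constantCoeff (R := A)) :=
    lt_of_le_of_ne h fun h' => hX (h' ▸ by simp)
  have h1 := (Ideal.height_add_one_le_of_lt_of_isPrime hlt).trans
    (height_comap_constantCoeff_le p.1.asIdeal)
  rw [p.2] at h1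
  have h2 : (2 + 1 : ℕ∞) ≤ 1 + 1 := (add_le_add_left hP 1).trans h1
  exact absurd h2 (by decide)

/-- The prime (X) has height at least one, and f shows that P contains it strictly. -/
theorem PowerSeries.two_le_height_of_X_mem [IsDomain A]
    {P : Ideal A⟦X⟧} [P.IsPrime] (hX : (X : A⟦X⟧) ∈ P) {f : A⟦X⟧} (hf : f ∈ P) (hf0 : constantCoeff f ≠ 0) : 2 ≤ P.height := by
  have : (Ideal.span {(X : A⟦X⟧)}).IsPrime := span_X_isPrime
  have hlt : Ideal.span {(X : A⟦X⟧)} < P :=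
    lt_of_le_of_ne ((Ideal.span_singleton_le_iff_mem _).2 hX) fun h =>
      hf0 (X_dvd_iff.1 (Ideal.mem_span_singleton.1 (h ▸ hf)))
  have h1 : 1 ≤ (Ideal.span {(X : A⟦X⟧)}).height :=
    Ideal.one_le_height_span_singleton_of_mem_nonZeroDivisors
      (mem_nonZeroDivisors_of_ne_zero X_ne_zero)
  exact (add_le_add_left h1 1).trans (Ideal.height_add_one_le_of_lt_of_isPrime hlt)

end PowerSeriesPrimes

/-! ### Kernel and cokernel of X, and dévissage -/

section EulerCharacteristic

open PowerSeries

variable {A : Type*} [CommRing A]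
variable {N : Type*} [AddCommGroup N] [Module A⟦X⟧ N]

theorem PowerSeries.X_smul_quotient (x : N ⧸ ((X : A⟦X⟧) • (⊤ : Submodule A⟦X⟧ N))) :
    (X : A⟦X⟧) • x = 0 := by
  obtain ⟨x, rfl⟩ := Submodule.Quotient.mk_surjective _ x
  rw [← Submodule.Quotient.mk_smul, Submodule.Quotient.mk_eq_zero]
  exact Submodule.smul_mem_pointwise_smul _ _ _ trivial

theorem PowerSeries.X_smul_torsionBy (x : Submodule.torsionBy A⟦X⟧ N (X : A⟦X⟧)) :
    (X : A⟦X⟧) • x = 0 :=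
  Subtype.ext ((Submodule.mem_torsionBy_iff _ _).1 x.2)

variable [Module A N] [IsScalarTower A A⟦X⟧ N]

theorem PowerSeries.smul_eq_constantCoeff_smul {x : N} (hx : (X : A⟦X⟧) • x = 0) (f : A⟦X⟧) :
    f • x = constantCoeff f • x := by
  obtain ⟨g, hg⟩ : (X : A⟦X⟧) ∣ f - C (constantCoeff f) := by
    rw [X_dvd_iff, map_sub, constantCoeff_C, sub_self]
  rw [← algebraMap_smul A⟦X⟧ (constantCoeff f) x, ← sub_eq_zero, ← sub_smul]
  change (f - C (constantCoeff f)) • x = 0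
  rw [hg, mul_comm, mul_smul, hx, smul_zero]

/-- When X acts as zero, a power series acts through its constant coefficient, so generators over
A⟦X⟧ already generate over A. -/
theorem PowerSeries.finite_of_X_smul_eq_zero [Module.Finite A⟦X⟧ N]
    (hN : ∀ x : N, (X : A⟦X⟧) • x = 0) : Module.Finite A N := by
  obtain ⟨s, hs⟩ := Module.Finite.fg_top (R := A⟦X⟧) (M := N)
  refine ⟨⟨s, eq_top_iff.2 fun x _ => ?_⟩⟩
  have hx : x ∈ Submodule.span A⟦X⟧ (s : Set N) := hs ▸ Submodule.mem_top
  induction hx using Submodule.span_induction with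
  | mem x hx => exact Submodule.subset_span hx
  | zero => exact zero_mem _
  | add x y _ _ hx hy => exact add_mem (hx trivial) (hy trivial)
  | smul f x _ hx =>
    rw [smul_eq_constantCoeff_smul (hN x)]
    exact Submodule.smul_mem _ _ (hx trivial)

theorem PowerSeries.constantCoeff_smul_quotient {f : A⟦X⟧} (hf : f ∈ Module.annihilator A⟦X⟧ N)
    (x : N ⧸ ((X : A⟦X⟧) • (⊤ : Submodule A⟦X⟧ N))) : constantCoeff f • x = 0 := by
  rw [← smul_eq_constantCoeff_smul (X_smul_quotient x)]
  obtain ⟨x, rfl⟩ := Submodule.Quotient.mk_surjective _ x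
  rw [← Submodule.Quotient.mk_smul, Module.mem_annihilator.1 hf, Submodule.Quotient.mk_zero]

theorem PowerSeries.constantCoeff_smul_torsionBy {f : A⟦X⟧}
    (hf : f ∈ Module.annihilator A⟦X⟧ N) (x : Submodule.torsionBy A⟦X⟧ N (X : A⟦X⟧)) :
    constantCoeff f • x = 0 := by
  refine (smul_eq_constantCoeff_smul (N := Submodule.torsionBy A⟦X⟧ N (X : A⟦X⟧))
    (X_smul_torsionBy x) f).symm.trans ?_
  exact Subtype.ext (Module.mem_annihilator.1 hf _)

theorem PowerSeries.finite_quotient [Module.Finite A⟦X⟧ N] :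
    Module.Finite A (N ⧸ ((X : A⟦X⟧) • (⊤ : Submodule A⟦X⟧ N))) :=
  finite_of_X_smul_eq_zero X_smul_quotient

theorem PowerSeries.finite_torsionBy [IsNoetherianRing A] [Module.Finite A⟦X⟧ N] :
    Module.Finite A (Submodule.torsionBy A⟦X⟧ N (X : A⟦X⟧)) :=
  finite_of_X_smul_eq_zero X_smul_torsionBy

/-- The local length of the kernel of `X` on an `A⟦X⟧`-module. -/
noncomputable abbrev kerLength (A N : Type*) [CommRing A] [AddCommGroup N] [Module A N]
    [Module A⟦X⟧ N] [IsScalarTower A A⟦X⟧ N] (p : HeightOnePrime A) : ℕ∞ :=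
  localLength p.1.asIdeal (Submodule.torsionBy A⟦X⟧ N (X : A⟦X⟧))

/-- The local length of the cokernel of `X` on an `A⟦X⟧`-module. -/
noncomputable abbrev cokerLength (A N : Type*) [CommRing A] [AddCommGroup N] [Module A N]
    [Module A⟦X⟧ N] [IsScalarTower A A⟦X⟧ N] (p : HeightOnePrime A) : ℕ∞ :=
  localLength p.1.asIdeal (N ⧸ ((X : A⟦X⟧) • (⊤ : Submodule A⟦X⟧ N)))

/-- Multiplication by `X` as an `A`-linear endomorphism. -/
noncomputable def mulX (A N : Type*) [CommRing A] [AddCommGroup N] [Module A N]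
    [Module A⟦X⟧ N] [IsScalarTower A A⟦X⟧ N] : N →ₗ[A] N :=
  (LinearMap.lsmul A⟦X⟧ N X).restrictScalars A

theorem mulX_apply (x : N) : mulX A N x = (X : A⟦X⟧) • x := rfl

theorem kerLength_eq (p : HeightOnePrime A) :
    kerLength A N p = localLength p.1.asIdeal (LinearMap.ker (mulX A N)) :=
  LinearEquiv.localLength_eq (N₁ := (Submodule.torsionBy A⟦X⟧ N (X : A⟦X⟧)).restrictScalars A) _
    (LinearEquiv.ofEq _ _ (by ext x; simp [mulX_apply]))

theorem cokerLength_eq (p : HeightOnePrime A) :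
    cokerLength A N p = localLength p.1.asIdeal (N ⧸ LinearMap.range (mulX A N)) := by
  refine LinearEquiv.localLength_eq _ ((Submodule.Quotient.restrictScalarsEquiv A
    ((X : A⟦X⟧) • (⊤ : Submodule A⟦X⟧ N))).symm ≪≫ₗ Submodule.quotEquivOfEq _ _ ?_)
  ext x
  simp [mulX_apply, Submodule.mem_smul_pointwise_iff_exists]

theorem cokerLength_eq_zero {f : A⟦X⟧} (hf : f ∈ Module.annihilator A⟦X⟧ N)
    {p : HeightOnePrime A} (hfp : constantCoeff f ∉ p.1.asIdeal) : cokerLength A N p = 0 :=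
  (localLength_eq_zero_iff _).2 fun x => ⟨_, hfp, constantCoeff_smul_quotient hf x⟩

theorem kerLength_add_cokerLength {N₁ N₂ N₃ : Type*}
    [AddCommGroup N₁] [Module A N₁] [Module A⟦X⟧ N₁] [IsScalarTower A A⟦X⟧ N₁]
    [AddCommGroup N₂] [Module A N₂] [Module A⟦X⟧ N₂] [IsScalarTower A A⟦X⟧ N₂]
    [AddCommGroup N₃] [Module A N₃] [Module A⟦X⟧ N₃] [IsScalarTower A A⟦X⟧ N₃]
    (f : N₁ →ₗ[A⟦X⟧] N₂) (g : N₂ →ₗ[A⟦X⟧] N₃)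
    (hf : Function.Injective f) (hg : Function.Surjective g) (hfg : Function.Exact f g)
    (p : HeightOnePrime A) :
    kerLength A N₂ p + (cokerLength A N₁ p + cokerLength A N₃ p) =
      kerLength A N₁ p + kerLength A N₃ p + cokerLength A N₂ p := by
  simp_rw [kerLength_eq, cokerLength_eq]
  exact localLength_ker_add_coker _ _ _ _ (f.restrictScalars A) (g.restrictScalars A) hf hg hfg
    (LinearMap.ext fun x => f.map_smul X x) (LinearMap.ext fun x => g.map_smul X x)

/-- The comparison of the kernel and the cokernel of `X` with pseudo-nullity. -/
structure EulerPositive (A N : Type*) [CommRing A] [AddCommGroup N] [Module A N]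
    [Module A⟦X⟧ N] [IsScalarTower A A⟦X⟧ N] : Prop where
  le : ∀ p, kerLength A N p ≤ cokerLength A N p
  eq_of_isPseudoNull : IsPseudoNull A⟦X⟧ N → ∀ p, kerLength A N p = cokerLength A N p
  isPseudoNull_of_eq : (∀ p, kerLength A N p = cokerLength A N p) → IsPseudoNull A⟦X⟧ N

/-- If `N/XN` is torsion over `A`, then `N` is annihilated by a power series with nonzero constant
coefficient. -/
theorem PowerSeries.exists_mem_annihilator_constantCoeff_ne_zero [IsDomain A]
    [Module.Finite A⟦X⟧ N] (hN : Module.IsTorsion A (N ⧸ ((X : A⟦X⟧) • (⊤ : Submodule A⟦X⟧ N)))) :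
    ∃ f ∈ Module.annihilator A⟦X⟧ N, constantCoeff f ≠ 0 := by
  have := finite_quotient (A := A) (N := N)
  obtain ⟨a, ha, ha0⟩ := (Submodule.ne_bot_iff _).1 hN.annihilator_ne_bot
  -- As a kills N/XN, a N ⊆ X N. Cayley–Hamilton gives a monic p with lower coefficients in (X) and
  -- p(a) N = 0; the constant coefficient of p(a) is a power of a.
  have hrange : LinearMap.range (algebraMap A⟦X⟧ (Module.End A⟦X⟧ N) (C a)) ≤
      Ideal.span {(X : A⟦X⟧)} • (⊤ : Submodule A⟦X⟧ N) := by
    rintro _ ⟨x, rfl⟩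
    have h := Module.mem_annihilator.1 ha (Submodule.Quotient.mk x)
    rw [← algebraMap_smul A⟦X⟧ a, ← Submodule.Quotient.mk_smul, Submodule.Quotient.mk_eq_zero] at h
    rwa [Submodule.ideal_span_singleton_smul]
  obtain ⟨p, hp, -, hcoeff, hp0⟩ :=
    LinearMap.exists_monic_and_natDegree_eq_and_coeff_mem_pow_and_aeval_eq_zero _ _ _ hrange
  refine ⟨p.eval (C a), Module.mem_annihilator.2 fun x => ?_, ?_⟩
  · rw [Polynomial.aeval_algebraMap_apply] at hp0
    exact LinearMap.congr_fun hp0 x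
  · rw [Polynomial.eval_eq_sum_range, map_sum, Finset.sum_range_succ, Finset.sum_eq_zero, zero_add,
      hp.coeff_natDegree, one_mul, map_pow, constantCoeff_C]
    · exact pow_ne_zero _ ha0
    · intro k hk
      have h1 : p.coeff k ∈ Ideal.span {(X : A⟦X⟧)} :=
        Ideal.pow_le_self (Nat.sub_ne_zero_of_lt (Finset.mem_range.1 hk)) (hcoeff k)
      rw [map_mul, X_dvd_iff.1 (Ideal.mem_span_singleton.1 h1), zero_mul]

variable [IsDomain A] [IsNoetherianRing A]

theorem IsKrullDomain.cokerLength_ne_top (hA : IsKrullDomain A) [Module.Finite A⟦X⟧ N]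
    {f : A⟦X⟧} (hf : f ∈ Module.annihilator A⟦X⟧ N) (hf0 : constantCoeff f ≠ 0)
    (p : HeightOnePrime A) : cokerLength A N p ≠ ⊤ :=
  have := finite_quotient (A := A) (N := N)
  hA.localLength_ne_top (fun {x} => ⟨⟨_, mem_nonZeroDivisors_of_ne_zero hf0⟩,
    constantCoeff_smul_quotient hf x⟩) p

theorem IsKrullDomain.eulerPositive_quotient (hA : IsKrullDomain A) [Module.Finite A⟦X⟧ N]
    (P : Ideal A⟦X⟧) [P.IsPrime] (e : N ≃ₗ[A⟦X⟧] A⟦X⟧ ⧸ P)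
    {f : A⟦X⟧} (hf : f ∈ Module.annihilator A⟦X⟧ N) (hf0 : constantCoeff f ≠ 0) :
    EulerPositive A N := by
  have hann : Module.annihilator A⟦X⟧ N = P := by
    rw [e.annihilator_eq, Ideal.annihilator_quotient]
  have hne : P ≠ ⊥ := (Submodule.ne_bot_iff _).2 ⟨f, hann ▸ hf, fun h => hf0 (by simp [h])⟩
  have hpn : IsPseudoNull A⟦X⟧ N ↔ 2 ≤ P.height := by
    rw [isPseudoNull_iff, two_le_height_iff, hann]
  by_cases hX : (X : A⟦X⟧) ∈ P
  · have hX0 (x : N) : (X : A⟦X⟧) • x = 0 := Module.mem_annihilator.1 (hann ▸ hX) x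
    have hm : mulX A N = 0 := LinearMap.ext hX0
    have heq (p) : kerLength A N p = cokerLength A N p := by
      rw [kerLength_eq, cokerLength_eq, hm, LinearMap.ker_zero, LinearMap.range_zero,
        Submodule.topEquiv.localLength_eq p.1.asIdeal,
        (Submodule.quotEquivOfEqBot (⊥ : Submodule A N) rfl).localLength_eq p.1.asIdeal]
    exact ⟨fun p => (heq p).le, fun _ => heq,
      fun _ => hpn.2 (two_le_height_of_X_mem hX (hann ▸ hf) hf0)⟩
  · have hker (p) : kerLength A N p = 0 := by
      rw [localLength_eq_zero_iff]
      refine fun x => ⟨1, p.1.asIdeal.one_notMem, ?_⟩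
      have h1 : Ideal.Quotient.mk P X * e x = 0 := by
        have := congrArg e ((Submodule.mem_torsionBy_iff _ _).1 x.2)
        rwa [map_smul, map_zero] at this
      have h2 := (mul_eq_zero.1 h1).resolve_left fun h => hX (Ideal.Quotient.eq_zero_iff_mem.1 h)
      rw [one_smul]
      exact Subtype.ext (e.map_eq_zero_iff.1 h2)
    refine ⟨fun p => by rw [hker]; exact zero_le, fun h p => ?_, fun h => ?_⟩
    · obtain ⟨g, hg, hgp⟩ := exists_constantCoeff_notMem (hpn.1 h) hX p
      rw [hker, cokerLength_eq_zero (hann ▸ hg) hgp]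
    · rw [hpn]
      by_contra hlt
      have h1 : P.height = 1 := by
        have h0 : P.height ≠ 0 := fun h => hne (Ideal.height_eq_zero_iff_eq_bot.1 h)
        rw [not_le] at hlt
        exact le_antisymm (Order.le_of_lt_add_one hlt) (Order.one_le_iff_ne_zero.2 h0)
      obtain ⟨p, hp⟩ := hA.exists_constantCoeff_mem h1 hX
      have hc : cokerLength A N p = 0 := by rw [← h, hker]
      -- A zero local cokernel puts some s ∉ p into (X) + P; taking constant coefficients gives s ∈
      -- p, a contradiction.
      obtain ⟨s, hs, hsx⟩ := (localLength_eq_zero_iff _).1 hc (Submodule.Quotient.mk (e.symm 1))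
      rw [← algebraMap_smul A⟦X⟧ s, ← Submodule.Quotient.mk_smul, Submodule.Quotient.mk_eq_zero,
        Submodule.mem_smul_pointwise_iff_exists] at hsx
      obtain ⟨y, -, hy⟩ := hsx
      obtain ⟨g, hg⟩ := Ideal.Quotient.mk_surjective (e y)
      have := congrArg e hy
      rw [map_smul, map_smul, e.apply_symm_apply, ← hg] at this
      replace this : Ideal.Quotient.mk P (X * g) = Ideal.Quotient.mk P (algebraMap A A⟦X⟧ s * 1) :=
        this
      rw [mul_one, eq_comm, Ideal.Quotient.eq] at this
      refine hs ?_
      have h2 := hp _ this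
      rw [map_sub, map_mul, constantCoeff_X, zero_mul, sub_zero] at h2
      rwa [show algebraMap A A⟦X⟧ s = C s from rfl, constantCoeff_C] at h2

theorem IsKrullDomain.eulerPositive_of_exact (hA : IsKrullDomain A) {N₁ N₂ N₃ : Type*}
    [AddCommGroup N₁] [Module A N₁] [Module A⟦X⟧ N₁] [IsScalarTower A A⟦X⟧ N₁]
    [AddCommGroup N₂] [Module A N₂] [Module A⟦X⟧ N₂] [IsScalarTower A A⟦X⟧ N₂]
    [AddCommGroup N₃] [Module A N₃] [Module A⟦X⟧ N₃] [IsScalarTower A A⟦X⟧ N₃]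
    [Module.Finite A⟦X⟧ N₁] [Module.Finite A⟦X⟧ N₂] [Module.Finite A⟦X⟧ N₃]
    (i : N₁ →ₗ[A⟦X⟧] N₂) (q : N₂ →ₗ[A⟦X⟧] N₃)
    (hi : Function.Injective i) (hq : Function.Surjective q) (hiq : Function.Exact i q)
    {f : A⟦X⟧} (hf : f ∈ Module.annihilator A⟦X⟧ N₂) (hf0 : constantCoeff f ≠ 0)
    (h₁ : EulerPositive A N₁) (h₃ : EulerPositive A N₃) : EulerPositive A N₂ := by
  have hf₁ : f ∈ Module.annihilator A⟦X⟧ N₁ := LinearMap.annihilator_le_of_injective i hi hf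
  have hf₃ : f ∈ Module.annihilator A⟦X⟧ N₃ := LinearMap.annihilator_le_of_surjective q hq hf
  have hfne : f ≠ 0 := fun h => hf0 (by simp [h])
  have hadd := kerLength_add_cokerLength i q hi hq hiq
  have hpn : IsPseudoNull A⟦X⟧ N₂ ↔ IsPseudoNull A⟦X⟧ N₁ ∧ IsPseudoNull A⟦X⟧ N₃ := by
    simp_rw [isPseudoNull_iff_localLength, localLength_eq_add_of_exact _ i q hi hq hiq,
      add_eq_zero, forall_and]
    exact ⟨fun h => ⟨⟨(Submodule.ne_bot_iff _).2 ⟨f, hf₁, hfne⟩, h.2.1⟩,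
        ⟨(Submodule.ne_bot_iff _).2 ⟨f, hf₃, hfne⟩, h.2.2⟩⟩,
      fun h => ⟨(Submodule.ne_bot_iff _).2 ⟨f, hf, hfne⟩, h.1.2, h.2.2⟩⟩
  -- All six lengths are finite, so additivity reads c₂ - k₂ = (c₁ - k₁) + (c₃ - k₃) with
  -- nonnegative summands.
  have hnat (p) : kerLength A N₂ p ≤ cokerLength A N₂ p ∧
      (kerLength A N₂ p = cokerLength A N₂ p ↔
        kerLength A N₁ p = cokerLength A N₁ p ∧ kerLength A N₃ p = cokerLength A N₃ p) := by
    have c₁ := hA.cokerLength_ne_top hf₁ hf0 p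
    have c₂ := hA.cokerLength_ne_top hf hf0 p
    have c₃ := hA.cokerLength_ne_top hf₃ hf0 p
    have l₁ := h₁.le p
    have l₃ := h₃.le p
    have k₁ := ne_top_of_le_ne_top c₁ l₁
    have k₃ := ne_top_of_le_ne_top c₃ l₃
    have hp := hadd p
    have k₂ : kerLength A N₂ p ≠ ⊤ := fun h => by
      rw [h, top_add, eq_comm, ENat.add_eq_top, ENat.add_eq_top] at hp
      exact hp.elim (fun hp => hp.elim k₁ k₃) c₂
    generalize kerLength A N₁ p = a₁ at *
    generalize kerLength A N₂ p = a₂ at *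
    generalize kerLength A N₃ p = a₃ at *
    generalize cokerLength A N₁ p = b₁ at *
    generalize cokerLength A N₂ p = b₂ at *
    generalize cokerLength A N₃ p = b₃ at *
    lift a₁ to ℕ using k₁
    lift a₂ to ℕ using k₂
    lift a₃ to ℕ using k₃
    lift b₁ to ℕ using c₁
    lift b₂ to ℕ using c₂
    lift b₃ to ℕ using c₃
    norm_cast at *
    omega
  refine ⟨fun p => (hnat p).1, fun h p => ?_, fun h => ?_⟩
  · obtain ⟨n₁, n₃⟩ := hpn.1 h
    exact (hnat p).2.2 ⟨h₁.eq_of_isPseudoNull n₁ p, h₃.eq_of_isPseudoNull n₃ p⟩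
  · exact hpn.2 ⟨h₁.isPseudoNull_of_eq fun p => ((hnat p).2.1 (h p)).1,
      h₃.isPseudoNull_of_eq fun p => ((hnat p).2.1 (h p)).2⟩

theorem IsKrullDomain.eulerPositive (hA : IsKrullDomain A) [hN : Module.Finite A⟦X⟧ N]
    {f : A⟦X⟧} (hf : f ∈ Module.annihilator A⟦X⟧ N) (hf0 : constantCoeff f ≠ 0) :
    EulerPositive A N := by
  -- The induction varies N as an A⟦X⟧-module only, so the compatible A-structure and the
  -- annihilation by f must be part of the statement proved.
  suffices h : ∀ [Module A N] [IsScalarTower A A⟦X⟧ N], f ∈ Module.annihilator A⟦X⟧ N →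
    EulerPositive A N from h hf
  clear hf
  induction hN using IsNoetherianRing.induction_on_isQuotientEquivQuotientPrime A⟦X⟧ with
  | subsingleton N =>
    intro _ _ hf
    have h0 (p) : kerLength A N p = cokerLength A N p := by
      rw [kerLength, cokerLength,
        (localLength_eq_zero_iff _).2 fun x => ⟨1, p.1.asIdeal.one_notMem, Subsingleton.elim _ _⟩,
        (localLength_eq_zero_iff _).2 fun x => ⟨1, p.1.asIdeal.one_notMem, Subsingleton.elim _ _⟩]
    refine ⟨fun p => (h0 p).le, fun _ => h0, fun _ => isPseudoNull_iff_localLength.2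
      ⟨(Submodule.ne_bot_iff _).2 ⟨f, hf, fun h => hf0 (by simp [h])⟩, fun p => ?_⟩⟩
    exact (localLength_eq_zero_iff _).2
      fun x => ⟨1, p.1.asIdeal.one_notMem, Subsingleton.elim _ _⟩
  | quotient N P e =>
    intro _ _ hf
    have := P.2
    exact hA.eulerPositive_quotient P.1 e hf hf0
  | exact N₁ N₂ N₃ i q hi hq hiq h₁ h₃ =>
    intro _ _ hf
    let : Module A N₁ := Module.compHom N₁ (algebraMap A A⟦X⟧)
    let : Module A N₃ := Module.compHom N₃ (algebraMap A A⟦X⟧)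
    have : IsScalarTower A A⟦X⟧ N₁ := .of_algebraMap_smul fun _ _ => rfl
    have : IsScalarTower A A⟦X⟧ N₃ := .of_algebraMap_smul fun _ _ => rfl
    exact hA.eulerPositive_of_exact i q hi hq hiq hf hf0
      (h₁ (LinearMap.annihilator_le_of_injective i hi hf))
      (h₃ (LinearMap.annihilator_le_of_surjective q hq hf))

end EulerCharacteristic

/-! ### The main theorem -/

theorem corollary2p8 {A M : Type*} [CommRing A] [IsDomain A] [IsNoetherianRing A]
    (hA : IsKrullDomain A) [AddCommGroup M] [Module A M] [Module A⟦X⟧ M]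
    [IsScalarTower A A⟦X⟧ M]
    (hMfin : Module.Finite A⟦X⟧ M) (hMtors : Module.IsTorsion A⟦X⟧ M)
    (hQfin : Module.Finite A (M ⧸ ((PowerSeries.X : A⟦X⟧) • (⊤ : Submodule A⟦X⟧ M))))
    (hQtors : Module.IsTorsion A (M ⧸ ((PowerSeries.X : A⟦X⟧) • (⊤ : Submodule A⟦X⟧ M)))) :
    (IsPseudoNull A⟦X⟧ M ↔
      charIdeal A (Submodule.torsionBy A⟦X⟧ M (PowerSeries.X : A⟦X⟧)) =
        charIdeal A (M ⧸ ((PowerSeries.X : A⟦X⟧) • (⊤ : Submodule A⟦X⟧ M)))) ∧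
    (IsPseudoNull A (M ⧸ ((PowerSeries.X : A⟦X⟧) • (⊤ : Submodule A⟦X⟧ M))) →
      IsPseudoNull A⟦X⟧ M) := by
  obtain ⟨f, hf, hf0⟩ := PowerSeries.exists_mem_annihilator_constantCoeff_ne_zero hQtors
  have hE := hA.eulerPositive hf hf0
  have := PowerSeries.finite_torsionBy (A := A) (N := M)
  have hKtors : Module.IsTorsion A (Submodule.torsionBy A⟦X⟧ M (PowerSeries.X : A⟦X⟧)) :=
    fun {x} => ⟨⟨_, mem_nonZeroDivisors_of_ne_zero hf0⟩,
      PowerSeries.constantCoeff_smul_torsionBy hf x⟩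
  refine ⟨?_, fun h => hE.isPseudoNull_of_eq fun p => ?_⟩
  · rw [hA.charIdeal_eq_iff hKtors hQtors]
    exact ⟨hE.eq_of_isPseudoNull, hE.isPseudoNull_of_eq⟩
  · have h0 : cokerLength A M p = 0 := h.localLength_eq_zero p
    have hle := hE.le p
    rw [h0] at hle ⊢
    exact le_bot_iff.1 hle
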